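/- Let $d\ge 1$, let $\phi:\mathbb R\to\mathbb R$ be Lipschitz continuous, and let $\sigma_u,\sigma_w,T>0$. For $L\ge 1$ put $\kappa=T/L$ and define kernels $C^{\ell,k}=C^{\ell,k}_L$ on $\mathbb R^d\times\mathbb R^d$ recursively by $$C^{0,k}(x,\bar x)=\delta_{0,k}\,\frac{\sigma_u^2}{d}\,x^{\top}\bar x,\qquad C^{\ell,k}(x,\bar x)=\sigma_w^2\,\mathbb E\big[\phi(u^{\ell-1})\,\phi(\bar u^{k-1})\big]\quad(\ell,k\ge 1),$$ where $(u^{\ell},\bar u^{k})=(u^{\ell}(x),u^{k}(\bar x))$ is a centered Gaussian pair whose covariances are given by $$\mathbb E\big[u^{\ell}(a)\,u^{k}(b)\big]=C^{0,0}(a,b)+\kappa^2\sum_{i=1}^{\ell}\sum_{j=1}^{k}C^{i,j}(a,b)\qquad(a,b\in\{x,\bar x\}).$$ Let $$S^{L}(x,\bar x)=C^{0,0}(x,\bar x)+\kappa^2\sum_{\ell,k=1}^{L}C^{\ell,k}(x,\bar x),\qquad S^{*}(x,\bar x)=\lim_{L\to\infty}S^{L}(x,\bar x).$$ Then for all $x,\bar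 x\in\mathbb S^{d-1}=\{z\in\mathbb R^d:\|z\|_2=1\}$: 1. $S^{*}(x,\bar x)$ is well defined, that is, for every $L\ge 1$ and all $0\le \ell,k\le L$ the covariance matrix of $(u^{\ell}(x),u^{k}(\bar x))$ is positive semidefinite and $\phi(u^{\ell}(x))\,\phi(u^{k}(\bar x))$ is integrable, and the limit defining $S^{*}(x,\bar x)$ exists in $\mathbb R$; moreover $0<S^{*}(x,x)=S^{*}(\bar x,\bar x)<\infty$. 2. $S^{*}(x,x)\ge S^{*}(x,\bar x)$, with equality if and only if $x=\bar x$. -/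

import Mathlib

open MeasureTheory ProbabilityTheory Filter Topology
open scoped NNReal

noncomputable section

namespace NeuralODE

/-- Joint law of a centered Gaussian pair `(u, ū)` with `E[u²] = a`, `E[u ū] = b`, `E[ū²] = c`. -/
def pairLaw (a b c : ℝ) : Measure (EuclideanSpace ℝ (Fin 2)) :=
  multivariateGaussian 0 !![a, b; b, c]

/-- `E[φ(u) φ(ū)]` for a centered Gaussian pair with `E[u²] = a`, `E[u ū] = b`, `E[ū²] = c`. -/
def dualMoment (φ : ℝ → ℝ) (a b c : ℝ) : ℝ :=
  ∫ w, φ (w 0) * φ (w 1) ∂(pairLaw a b c)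

/-- The kernels `C^{ℓ,k}(x, y)` of the residual network with step size `κ`. With
`Q^{ℓ,k}(x, y) = C^{0,0}(x, y) + κ² ∑_{i=1}^{ℓ} ∑_{j=1}^{k} C^{i,j}(x, y)`
the recursion is `C^{ℓ+1,k+1}(x, y) = σ_w² E[φ(u^ℓ) φ(ū^k)]`, where `(u^ℓ, ū^k)` is centered Gaussian
with `E[u^ℓ u^ℓ] = Q^{ℓ,ℓ}(x, x)`, `E[u^ℓ ū^k] = Q^{ℓ,k}(x, y)`, `E[ū^k ū^k] = Q^{k,k}(y, y)`;
see `kernelC_succ_succ`. -/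
def kernelC {d : ℕ} (φ : ℝ → ℝ) (σu σw κ : ℝ) :
    ℕ → ℕ → EuclideanSpace ℝ (Fin d) → EuclideanSpace ℝ (Fin d) → ℝ
  | 0, 0, x, y => σu ^ 2 / d * inner ℝ x y
  | 0, _ + 1, _, _ => 0
  | _ + 1, 0, _, _ => 0
  | ℓ + 1, k + 1, x, y =>
      σw ^ 2 * dualMoment φ
        (σu ^ 2 / d * inner ℝ x x
          + κ ^ 2 * ∑ i : Fin ℓ, ∑ j : Fin ℓ, kernelC φ σu σw κ (i + 1) (j + 1) x x)
        (σu ^ 2 / d * inner ℝ x y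
          + κ ^ 2 * ∑ i : Fin ℓ, ∑ j : Fin k, kernelC φ σu σw κ (i + 1) (j + 1) x y)
        (σu ^ 2 / d * inner ℝ y y
          + κ ^ 2 * ∑ i : Fin k, ∑ j : Fin k, kernelC φ σu σw κ (i + 1) (j + 1) y y)
termination_by ℓ k => max ℓ k
decreasing_by
  all_goals have hi := i.isLt
  all_goals have hj := j.isLt
  all_goals omega

/-- The pre-activation covariance
`E[u^ℓ(x) u^k(y)] = C^{0,0}(x, y) + κ² ∑_{i=1}^{ℓ} ∑_{j=1}^{k} C^{i,j}(x, y)`. -/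
def preactCov {d : ℕ} (φ : ℝ → ℝ) (σu σw κ : ℝ) (ℓ k : ℕ) (x y : EuclideanSpace ℝ (Fin d)) : ℝ :=
  kernelC φ σu σw κ 0 0 x y
    + κ ^ 2 * ∑ i ∈ Finset.Icc 1 ℓ, ∑ j ∈ Finset.Icc 1 k, kernelC φ σu σw κ i j x y

/-- `S^L(x, y)`: the pre-activation covariance at the last layer of the depth-`L` network,
with step size `κ = T / L`. -/
def depthCov {d : ℕ} (φ : ℝ → ℝ) (σu σw T : ℝ) (L : ℕ) (x y : EuclideanSpace ℝ (Fin d)) : ℝ :=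
  preactCov φ σu σw (T / L) L L x y

/-- `S*(x, y) = lim_{L → ∞} S^L(x, y)`; meaningful when the limit exists. -/
def limitCov {d : ℕ} (φ : ℝ → ℝ) (σu σw T : ℝ) (x y : EuclideanSpace ℝ (Fin d)) : ℝ :=
  limUnder atTop (fun L : ℕ => depthCov φ σu σw T L x y)

theorem sum_Icc_one_eq_sum_fin (n : ℕ) (f : ℕ → ℝ) :
    ∑ i ∈ Finset.Icc 1 n, f i = ∑ i : Fin n, f (i + 1) := by
  rw [Fin.sum_univ_eq_sum_range (fun i => f (i + 1)) n]
  induction n with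
  | zero => simp
  | succ n ih => rw [Finset.sum_range_succ, Finset.sum_Icc_succ_top (by omega), ih]

theorem kernelC_zero_zero {d : ℕ} (φ : ℝ → ℝ) (σu σw κ : ℝ) (x y : EuclideanSpace ℝ (Fin d)) :
    kernelC φ σu σw κ 0 0 x y = σu ^ 2 / d * inner ℝ x y := by
  rw [kernelC]

theorem kernelC_zero_succ {d : ℕ} (φ : ℝ → ℝ) (σu σw κ : ℝ) (k : ℕ)
    (x y : EuclideanSpace ℝ (Fin d)) : kernelC φ σu σw κ 0 (k + 1) x y = 0 := by
  rw [kernelC]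

theorem kernelC_succ_succ {d : ℕ} (φ : ℝ → ℝ) (σu σw κ : ℝ) (ℓ k : ℕ)
    (x y : EuclideanSpace ℝ (Fin d)) :
    kernelC φ σu σw κ (ℓ + 1) (k + 1) x y =
      σw ^ 2 * dualMoment φ (preactCov φ σu σw κ ℓ ℓ x x) (preactCov φ σu σw κ ℓ k x y)
        (preactCov φ σu σw κ k k y y) := by
  rw [kernelC]
  simp only [preactCov, kernelC_zero_zero, sum_Icc_one_eq_sum_fin]

end NeuralODE

end

/-! The recursion is the Gram matrix of an Euler scheme in a Hilbert space. An isonormal process `W`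
is a linear isometry under which `(W h, W k)` is Gaussian with covariances the inner products of `h`
and `k`, so `φ ∘ W h` has Gram kernel `dualMoment φ` (`inner_superpose`). On `H = ℝ^d ⊕ L²` with `W
: H → L²`, the drift `G h = (0, σw • φ ∘ W h)` maps `H` to itself and is Lipschitz. Started from `z
x = ((σu/√d) x, 0)`, the Euler iterates with step `κ` have inner products `preactCov`
(`preactCov_eq_inner_eulerScheme`); positivity and integrability follow.

Euler schemes of a Lipschitz field converge (`exists_tendsto_eulerScheme`), so `S*(x, y) = ⟪u (z x),
u (z y)⟫` with `u` the limit map at time `T`. The drift never touches the `ℝ^d` component, hence `‖u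
(z x) - u (z y)‖² ≥ σu²/d ‖x - y‖²`. On the sphere `S*(x, x) = S*(y, y)`, so the left side is `2
(S*(x, x) - S*(x, y))`, which gives the inequality and its equality case. -/

noncomputable section
-- Isonormal Gaussian processes
namespace NeuralODE

/-- The law of a sequence of independent standard Gaussian variables. -/
def gaussianSeq : Measure (ℕ → ℝ) := Measure.infinitePi fun _ => gaussianReal 0 1

instance : IsProbabilityMeasure gaussianSeq := by unfold gaussianSeq; infer_instance

theorem map_eval_gaussianSeq (n : ℕ) : gaussianSeq.map (fun ω => ω n) = gaussianReal 0 1 := by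
  unfold gaussianSeq
  exact Measure.infinitePi_map_eval _ n

theorem measurePreserving_eval_gaussianSeq (n : ℕ) :
    MeasurePreserving (fun ω : ℕ → ℝ => ω n) gaussianSeq (gaussianReal 0 1) :=
  ⟨measurable_pi_apply n, map_eval_gaussianSeq n⟩

theorem memLp_eval_gaussianSeq (n : ℕ) : MemLp (fun ω : ℕ → ℝ => ω n) 2 gaussianSeq :=
  (memLp_id_gaussianReal (μ := 0) (v := 1) 2).comp_measurePreserving
    (measurePreserving_eval_gaussianSeq n)

theorem iIndepFun_eval_gaussianSeq :
    iIndepFun (fun (n : ℕ) (ω : ℕ → ℝ) => ω n) gaussianSeq :=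
  iIndepFun_infinitePi (X := fun _ x => x) (fun _ => measurable_id)

theorem integral_eval_gaussianSeq (n : ℕ) : ∫ ω, ω n ∂gaussianSeq = 0 := by
  have h := integral_map (μ := gaussianSeq) (φ := fun ω : ℕ → ℝ => ω n) (f := fun x : ℝ => x)
    (measurable_pi_apply n).aemeasurable (by fun_prop)
  rw [map_eval_gaussianSeq] at h
  rw [← h, integral_id_gaussianReal]

theorem integral_eval_sq_gaussianSeq (n : ℕ) : ∫ ω, ω n * ω n ∂gaussianSeq = 1 := by
  have h := integral_map (μ := gaussianSeq) (φ := fun ω : ℕ → ℝ => ω n) (f := fun x : ℝ => x * x)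
    (measurable_pi_apply n).aemeasurable (by fun_prop)
  rw [map_eval_gaussianSeq] at h
  have hv := variance_fun_id_gaussianReal (μ := 0) (v := 1)
  rw [variance_of_integral_eq_zero (by fun_prop) integral_id_gaussianReal] at hv
  simp only [NNReal.coe_one, pow_two] at hv
  rw [← h, hv]

/-- The `n`-th coordinate as an element of `L²`. -/
def coordLp (n : ℕ) : Lp ℝ 2 gaussianSeq := (memLp_eval_gaussianSeq n).toLp _

theorem coeFn_coordLp (n : ℕ) : coordLp n =ᵐ[gaussianSeq] fun ω => ω n := MemLp.coeFn_toLp _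

theorem orthonormal_coordLp : Orthonormal ℝ coordLp := by
  rw [orthonormal_iff_ite]
  intro m n
  have h : inner ℝ (coordLp m) (coordLp n) = ∫ ω, ω m * ω n ∂gaussianSeq := by
    rw [L2.inner_def]
    refine integral_congr_ae ?_
    filter_upwards [coeFn_coordLp m, coeFn_coordLp n] with ω h₁ h₂
    simp [h₁, h₂, mul_comm]
  rw [h]
  split_ifs with hmn
  · rw [hmn, integral_eval_sq_gaussianSeq]
  · have := (iIndepFun_eval_gaussianSeq.indepFun hmn).integral_fun_mul_eq_mul_integral
      (measurable_pi_apply m).aestronglyMeasurable (measurable_pi_apply n).aestronglyMeasurable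
    rw [this, integral_eval_gaussianSeq, zero_mul]

/-- The characteristic functional of a real-valued square-integrable function. -/
def charLp (f : Lp ℝ 2 gaussianSeq) : ℂ := ∫ ω, Complex.exp (Complex.I * f ω) ∂gaussianSeq

theorem norm_exp_I_mul_sub_le (a b : ℝ) :
    ‖Complex.exp (Complex.I * a) - Complex.exp (Complex.I * b)‖ ≤ |a - b| := by
  have h : Complex.exp (Complex.I * a) - Complex.exp (Complex.I * b)
      = Complex.exp (Complex.I * b) * (Complex.exp (Complex.I * ((a - b : ℝ) : ℂ)) - 1) := by
    rw [mul_sub, ← Complex.exp_add]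
    push_cast
    ring_nf
  rw [h, norm_mul, mul_comm Complex.I (b : ℂ), Complex.norm_exp_ofReal_mul_I, one_mul]
  exact Real.norm_exp_I_mul_ofReal_sub_one_le

theorem integrable_exp_I_mul (f : Lp ℝ 2 gaussianSeq) :
    Integrable (fun ω => Complex.exp (Complex.I * f ω)) gaussianSeq := by
  refine Integrable.of_bound (C := 1) ?_ (ae_of_all _ fun ω => ?_)
  · have := (Lp.aestronglyMeasurable f)
    exact Continuous.comp_aestronglyMeasurable (g := fun x : ℝ => Complex.exp (Complex.I * x))
      (by fun_prop) this
  · rw [mul_comm, Complex.norm_exp_ofReal_mul_I]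

theorem integral_abs_le_norm (f : Lp ℝ 2 gaussianSeq) : ∫ ω, |f ω| ∂gaussianSeq ≤ ‖f‖ := by
  have h1 : eLpNorm f 1 gaussianSeq ≤ eLpNorm f 2 gaussianSeq :=
    eLpNorm_le_eLpNorm_of_exponent_le (by norm_num) (Lp.aestronglyMeasurable f)
  have h2 : MemLp f 1 gaussianSeq := (Lp.memLp f).mono_exponent (by norm_num)
  have h3 : ∫ ω, |f ω| ∂gaussianSeq = (eLpNorm f 1 gaussianSeq).toReal := by
    rw [eLpNorm_one_eq_lintegral_enorm, ← integral_norm_eq_lintegral_enorm h2.1]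
    rfl
  rw [h3, Lp.norm_def]
  exact ENNReal.toReal_mono (Lp.eLpNorm_ne_top f) h1

/-- Combines `|e^{ia} - e^{ib}| ≤ |a - b|` with `L¹ ≤ L²` on a probability space. Continuity carries
the Gaussian formula from finite combinations to their `L²` limits. -/
theorem lipschitzWith_charLp : LipschitzWith 1 charLp := by
  refine LipschitzWith.of_dist_le_mul fun f g => ?_
  rw [dist_eq_norm, dist_eq_norm, NNReal.coe_one, one_mul, charLp, charLp,
    ← integral_sub (integrable_exp_I_mul f) (integrable_exp_I_mul g)]
  refine (norm_integral_le_integral_norm _).trans (le_trans ?_ (integral_abs_le_norm (f - g)))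
  refine integral_mono_ae ((integrable_exp_I_mul f).sub (integrable_exp_I_mul g)).norm
    (((Lp.memLp (f - g)).mono_exponent (by norm_num)).integrable le_rfl).abs ?_
  filter_upwards [Lp.coeFn_sub f g] with ω h
  rw [h]
  exact norm_exp_I_mul_sub_le _ _

theorem charFun_smul_eval (c : ℝ) (n : ℕ) :
    charFun (gaussianSeq.map fun ω => c * ω n) 1 = Complex.exp (-(c : ℂ) ^ 2 / 2) := by
  have h : (gaussianSeq.map fun ω => c * ω n) = (gaussianReal 0 1).map (c * ·) := by
    rw [← map_eval_gaussianSeq n, Measure.map_map (by fun_prop) (by fun_prop)]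
    rfl
  rw [h, charFun_map_mul, charFun_gaussianReal]
  simp [neg_div]

theorem charLp_sum {ι : Type*} (s : Finset ι) (f : ι → ℕ) (hf : Function.Injective f) (c : ι → ℝ) :
    charLp (∑ i ∈ s, c i • coordLp (f i)) = Complex.exp (-(∑ i ∈ s, (c i : ℂ) ^ 2) / 2) := by
  have hind : iIndepFun (fun (i : ι) (ω : ℕ → ℝ) => c i * ω (f i)) gaussianSeq :=
    (iIndepFun_eval_gaussianSeq.precomp hf).comp (fun i x => c i * x) (fun i => by fun_prop)
  have hmeas : ∀ i, AEMeasurable (fun ω : ℕ → ℝ => c i * ω (f i)) gaussianSeq := by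
    intro i
    have h : Measurable fun ω : ℕ → ℝ => ω (f i) := measurable_pi_apply (f i)
    exact (h.const_mul (c i)).aemeasurable
  have h2 := iIndepFun.charFun_map_fun_finsetSum_eq_prod (s := s) (fun i _ => hmeas i)
    (hind.restrict s)
  have h3 : charLp (∑ i ∈ s, c i • coordLp (f i))
      = charFun (gaussianSeq.map fun ω => ∑ i ∈ s, c i * ω (f i)) 1 := by
    rw [charFun_apply, integral_map (by fun_prop) (by fun_prop), charLp]
    refine integral_congr_ae ?_
    have hc : ∀ᵐ ω ∂gaussianSeq, ∀ n, coordLp n ω = ω n := ae_all_iff.2 coeFn_coordLp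
    have hs : ∀ i, ∀ᵐ ω ∂gaussianSeq, (c i • coordLp (f i)) ω = c i * coordLp (f i) ω := fun i =>
      Lp.coeFn_smul _ _
    have hsum : ∀ t : Finset ι, ∀ᵐ ω ∂gaussianSeq,
        (∑ i ∈ t, c i • coordLp (f i) : Lp ℝ 2 gaussianSeq) ω = ∑ i ∈ t, c i * ω (f i) := by
      classical
      intro t
      induction t using Finset.induction_on with
      | empty =>
        filter_upwards with ω
        simp
      | insert a t ha ih =>
        rw [Finset.sum_insert ha]
        filter_upwards [ih, hs a, hc, Lp.coeFn_add (c a • coordLp (f a))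
          (∑ i ∈ t, c i • coordLp (f i))] with ω h₁ h₂ h₃ h₄
        rw [h₄, Pi.add_apply, h₁, h₂, h₃, Finset.sum_insert ha]
    filter_upwards [hsum s] with ω h
    rw [h]
    simp [mul_comm]
  rw [h3, h2, Finset.prod_apply]
  simp_rw [charFun_smul_eval]
  rw [← Complex.exp_sum, ← Finset.sum_div, Finset.sum_neg_distrib]

/-- Distinct vectors lie at distance `√2 > 1`, so balls of radius `1/2` around them are disjoint
open sets. -/
theorem _root_.Orthonormal.countable_of_separable {E ι : Type*} [NormedAddCommGroup E]
    [InnerProductSpace ℝ E] [TopologicalSpace.SeparableSpace E] {v : ι → E}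
    (hv : Orthonormal ℝ v) : Countable ι := by
  have h : (Set.univ : Set ι).Countable := by
    refine Set.PairwiseDisjoint.countable_of_isOpen (s := fun i => Metric.ball (v i) (1 / 2)) ?_
      (fun _ _ => Metric.isOpen_ball) (fun i _ => ⟨v i, Metric.mem_ball_self (by norm_num)⟩)
    intro i _ j _ hij
    refine Metric.ball_disjoint_ball ?_
    have h2 : ‖v i - v j‖ ^ 2 = 2 := by
      rw [norm_sub_sq_real, hv.1, hv.1, hv.2 hij]
      norm_num
    rw [dist_eq_norm]
    nlinarith [norm_nonneg (v i - v j)]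
  exact Set.countable_univ_iff.1 h

/-- Every separable Hilbert space carries an isonormal Gaussian process. -/
theorem exists_isonormal (H : Type*) [NormedAddCommGroup H] [InnerProductSpace ℝ H]
    [CompleteSpace H] [TopologicalSpace.SeparableSpace H] :
    ∃ W : H →ₗᵢ[ℝ] Lp ℝ 2 gaussianSeq, ∀ h, charLp (W h) = Complex.exp (-(‖h‖ : ℂ) ^ 2 / 2) := by
  obtain ⟨w, b, -⟩ := exists_hilbertBasis ℝ H
  have := b.orthonormal.countable_of_separable
  obtain ⟨f, hf⟩ := exists_injective_nat w
  have hW := (orthonormal_coordLp.comp f hf).orthogonalFamily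
  let W : H →ₗᵢ[ℝ] Lp ℝ 2 gaussianSeq := hW.linearIsometry.comp b.repr.toLinearIsometry
  have hWb : ∀ i, W (b i) = coordLp (f i) := by
    intro i
    classical
    change hW.linearIsometry (b.repr (b i)) = coordLp (f i)
    rw [HilbertBasis.repr_self, hW.linearIsometry_apply_single]
    simp
  refine ⟨W, fun h => ?_⟩
  have hsum := b.hasSum_repr h
  -- Both sides are continuous in `h`, so it suffices to compare them on partial sums of the basis
  -- expansion.
  have h1 : Tendsto (fun s : Finset w => charLp (W (∑ i ∈ s, b.repr h i • b i))) atTop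
      (𝓝 (charLp (W h))) :=
    ((lipschitzWith_charLp.continuous.comp W.continuous).tendsto h).comp hsum
  have h2 : Tendsto (fun s : Finset w =>
      Complex.exp (-(‖∑ i ∈ s, b.repr h i • b i‖ : ℂ) ^ 2 / 2)) atTop
      (𝓝 (Complex.exp (-(‖h‖ : ℂ) ^ 2 / 2))) := by
    have hc : Continuous fun h : H => Complex.exp (-(‖h‖ : ℂ) ^ 2 / 2) := by fun_prop
    exact (hc.tendsto h).comp hsum
  refine tendsto_nhds_unique h1 (h2.congr fun s => ?_)
  rw [map_sum]
  simp_rw [map_smul, hWb]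
  rw [charLp_sum s f hf]
  congr 3
  have := b.orthonormal.inner_sum (fun i => b.repr h i) (fun i => b.repr h i) s
  rw [real_inner_self_eq_norm_sq] at this
  rw [← Complex.ofReal_pow, this]
  simp [pow_two]

end NeuralODE
end

/-! ### Convergence of the Euler scheme for a Lipschitz field -/

noncomputable section
namespace NeuralODE
section Euler

variable {E : Type*} [NormedAddCommGroup E] [NormedSpace ℝ E]

/-- The explicit Euler scheme with step size `κ` for the autonomous equation `u' = G u`. -/
def eulerScheme (G : E → E) (κ : ℝ) (z : E) : ℕ → E
  | 0 => z
  | n + 1 => eulerScheme G κ z n + κ • G (eulerScheme G κ z n)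

theorem eulerScheme_succ (G : E → E) (κ : ℝ) (z : E) (n : ℕ) :
    eulerScheme G κ z (n + 1) = eulerScheme G κ z n + κ • G (eulerScheme G κ z n) := rfl

theorem eulerScheme_add_eq_sum (G : E → E) (κ : ℝ) (z : E) (n r : ℕ) :
    eulerScheme G κ z (n + r)
      = eulerScheme G κ z n + κ • ∑ i ∈ Finset.range r, G (eulerScheme G κ z (n + i)) := by
  induction r with
  | zero => simp
  | succ r ih =>
    rw [← add_assoc, eulerScheme_succ, Finset.sum_range_succ, smul_add, ← add_assoc, ← ih]

theorem eulerScheme_eq_sum (G : E → E) (κ : ℝ) (z : E) (n : ℕ) :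
    eulerScheme G κ z n = z + κ • ∑ i ∈ Finset.range n, G (eulerScheme G κ z i) := by
  simpa [eulerScheme] using eulerScheme_add_eq_sum G κ z 0 n

variable {G : E → E} {K : ℝ≥0} (hG : LipschitzWith K G)
include hG

/-- Discrete Grönwall: one step multiplies `‖G‖` by at most `1 + κK ≤ e^{κK}`. -/
theorem norm_apply_eulerScheme_le {κ : ℝ} (hκ : 0 ≤ κ) (z : E) (n : ℕ) :
    ‖G (eulerScheme G κ z n)‖ ≤ Real.exp (n * (κ * K)) * ‖G z‖ := by
  induction n with
  | zero => simp [eulerScheme]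
  | succ n ih =>
    have h1 : ‖G (eulerScheme G κ z (n + 1))‖ ≤ (1 + κ * K) * ‖G (eulerScheme G κ z n)‖ := by
      have h := hG.dist_le_mul (eulerScheme G κ z (n + 1)) (eulerScheme G κ z n)
      rw [dist_eq_norm, dist_eq_norm, eulerScheme_succ, add_sub_cancel_left, norm_smul,
        Real.norm_of_nonneg hκ, ← eulerScheme_succ] at h
      have h' := norm_le_norm_add_norm_sub' (G (eulerScheme G κ z (n + 1)))
        (G (eulerScheme G κ z n))
      linarith
    have h2 : 1 + κ * K ≤ Real.exp (κ * K) := by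
      linarith [Real.add_one_le_exp (κ * K)]
    calc ‖G (eulerScheme G κ z (n + 1))‖ ≤ (1 + κ * K) * ‖G (eulerScheme G κ z n)‖ := h1
      _ ≤ Real.exp (κ * K) * (Real.exp (n * (κ * K)) * ‖G z‖) := by gcongr
      _ = Real.exp ((n + 1 : ℕ) * (κ * K)) * ‖G z‖ := by
        rw [← mul_assoc, ← Real.exp_add]
        push_cast
        ring_nf

/-- One coarse step is compared with `m` fine ones. The fine scheme drifts by at most `κB`
meanwhile, so the error obeys `e' ≤ e + κK(e + κB)`. -/
theorem norm_eulerScheme_sub_refine_le {κ B : ℝ} (hκ : 0 ≤ κ) {m N : ℕ} (hm : 0 < m) (z : E)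
    (hB : ∀ n ≤ m * N, ‖G (eulerScheme G (κ / m) z n)‖ ≤ B) (ℓ : ℕ) (hℓ : ℓ ≤ N) :
    ‖eulerScheme G κ z ℓ - eulerScheme G (κ / m) z (m * ℓ)‖
      ≤ κ * B * (Real.exp (ℓ * (κ * K)) - 1) := by
  have hm' : (0 : ℝ) < m := by exact_mod_cast hm
  have hB0 : 0 ≤ B := (norm_nonneg _).trans (hB 0 (Nat.zero_le _))
  induction ℓ with
  | zero => simp [eulerScheme]
  | succ ℓ ih =>
    set e := ‖eulerScheme G κ z ℓ - eulerScheme G (κ / m) z (m * ℓ)‖ with he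
    have ih' := ih (by omega)
    have hmid : ∀ r ∈ Finset.range m,
        ‖eulerScheme G (κ / m) z (m * ℓ + r) - eulerScheme G (κ / m) z (m * ℓ)‖ ≤ κ * B := by
      intro r hr
      have hr' := Finset.mem_range.1 hr
      rw [eulerScheme_add_eq_sum, add_sub_cancel_left, norm_smul,
        Real.norm_of_nonneg (by positivity)]
      have : ‖∑ i ∈ Finset.range r, G (eulerScheme G (κ / m) z (m * ℓ + i))‖ ≤ m * B := by
        refine (norm_sum_le_of_le _ (f := fun i => G (eulerScheme G (κ / m) z (m * ℓ + i)))
          (n := fun _ => B) fun i hi => hB _ ?_).trans ?_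
        · have := Finset.mem_range.1 hi
          nlinarith
        · rw [Finset.sum_const, Finset.card_range, nsmul_eq_mul]
          gcongr
      calc κ / m * _ ≤ κ / m * (m * B) := by gcongr
        _ = κ * B := by field_simp
    have hdec : eulerScheme G κ z (ℓ + 1) - eulerScheme G (κ / m) z (m * (ℓ + 1))
        = (eulerScheme G κ z ℓ - eulerScheme G (κ / m) z (m * ℓ))
          + (κ / m) • ∑ r ∈ Finset.range m,
            (G (eulerScheme G κ z ℓ) - G (eulerScheme G (κ / m) z (m * ℓ + r))) := by
      rw [Nat.mul_add, mul_one, eulerScheme_succ, eulerScheme_add_eq_sum G (κ / m), Finset.sum_sub_distrib,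
        Finset.sum_const, Finset.card_range, smul_sub, ← Nat.cast_smul_eq_nsmul ℝ, smul_smul,
        div_mul_cancel₀ _ hm'.ne']
      abel
    have hterm : ∀ r ∈ Finset.range m,
        ‖G (eulerScheme G κ z ℓ) - G (eulerScheme G (κ / m) z (m * ℓ + r))‖
          ≤ K * (e + κ * B) := by
      intro r hr
      have h := hG.dist_le_mul (eulerScheme G κ z ℓ) (eulerScheme G (κ / m) z (m * ℓ + r))
      rw [dist_eq_norm, dist_eq_norm] at h
      refine h.trans ?_
      gcongr
      refine (norm_sub_le_norm_sub_add_norm_sub _ (eulerScheme G (κ / m) z (m * ℓ)) _).trans ?_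
      rw [← he, norm_sub_rev (eulerScheme G (κ / m) z (m * ℓ))]
      gcongr
      exact hmid r hr
    have hsum := norm_sum_le_of_le _ hterm
    rw [Finset.sum_const, Finset.card_range, nsmul_eq_mul] at hsum
    have hstep : ‖eulerScheme G κ z (ℓ + 1) - eulerScheme G (κ / m) z (m * (ℓ + 1))‖
        ≤ e + κ * K * (e + κ * B) := by
      rw [hdec]
      refine (norm_add_le _ _).trans ?_
      rw [norm_smul, Real.norm_of_nonneg (by positivity)]
      have : κ / m * (m * (K * (e + κ * B))) = κ * K * (e + κ * B) := by field_simp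
      rw [← this]
      gcongr
    have hexp : 1 + κ * K ≤ Real.exp (κ * K) := by
      linarith [Real.add_one_le_exp (κ * K)]
    have he2 : Real.exp ((ℓ + 1 : ℕ) * (κ * K)) = Real.exp (κ * K) * Real.exp (ℓ * (κ * K)) := by
      rw [← Real.exp_add]
      push_cast
      ring_nf
    -- Adding `κB` to the error makes the recursion geometric with ratio `1 + κK`.
    have hmain : (1 + κ * K) * (e + κ * B) ≤ Real.exp (κ * K) * (κ * B * Real.exp (ℓ * (κ * K))) := by
      gcongr
      linarith
    rw [he2]
    linarith

/-- The Euler approximations at time `T` with `L` steps converge as `L → ∞`. -/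
theorem exists_tendsto_eulerScheme [CompleteSpace E] {T : ℝ} (hT : 0 ≤ T) (z : E) :
    ∃ u, Tendsto (fun L : ℕ => eulerScheme G (T / L) z L) atTop (𝓝 u) := by
  set B := Real.exp (T * K) * ‖G z‖ with hBdef
  set C := T * B * (Real.exp (T * K) - 1) with hC
  have hrefine : ∀ L m : ℕ, 0 < L → 0 < m →
      dist (eulerScheme G (T / L) z L) (eulerScheme G (T / (m * L : ℕ)) z (m * L)) ≤ C / L := by
    intro L m hL hm
    have hL' : (0 : ℝ) < L := by exact_mod_cast hL
    have hm' : (0 : ℝ) < m := by exact_mod_cast hm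
    have hstep : T / (m * L : ℕ) = T / L / m := by
      push_cast
      field_simp
    have h := norm_eulerScheme_sub_refine_le hG (κ := T / L) (B := B) (by positivity)
      (N := L) hm z ?_ L le_rfl
    · rw [dist_eq_norm, hstep]
      refine h.trans (le_of_eq ?_)
      have : (L : ℝ) * (T / L * K) = T * K := by field_simp
      rw [this, hC]
      ring
    · intro n hn
      refine (norm_apply_eulerScheme_le hG (by positivity) z n).trans ?_
      refine mul_le_mul_of_nonneg_right (Real.exp_le_exp.2 ?_) (norm_nonneg _)
      have hn' : (n : ℝ) ≤ m * L := by exact_mod_cast hn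
      calc (n : ℝ) * (T / L / m * K) ≤ (m * L) * (T / L / m * K) := by gcongr
        _ = T * K := by field_simp
  refine cauchySeq_tendsto_of_complete (Metric.cauchySeq_iff'.2 fun ε hε => ?_)
  have hC0 : 0 ≤ C := by
    have : 1 ≤ Real.exp (T * K) := Real.one_le_exp (by positivity)
    have : 0 ≤ Real.exp (T * K) - 1 := by linarith
    positivity
  obtain ⟨N, hN⟩ := exists_nat_gt (2 * C / ε)
  have hN0 : (0 : ℝ) < N := lt_of_le_of_lt (by positivity) hN
  have hN0' : 0 < N := by exact_mod_cast hN0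
  refine ⟨N, fun n hn => ?_⟩
  have hn0 : 0 < n := by omega
  have h1 := hrefine n N hn0 hN0'
  have h2 := hrefine N n hN0' hn0
  -- The schemes with `n` and `N` steps are compared through their common refinement with `N * n`
  -- steps.
  rw [mul_comm n N] at h2
  rw [dist_comm] at h2
  have h3 : C / n ≤ C / N := by gcongr
  have h4 : C / N + C / N < ε := by
    rw [div_lt_iff₀ hε] at hN
    rw [← add_div, div_lt_iff₀ hN0]
    linarith
  linarith [dist_triangle (eulerScheme G (T / n) z n)
    (eulerScheme G (T / (N * n : ℕ)) z (N * n)) (eulerScheme G (T / N) z N)]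

end Euler
end NeuralODE
end

/-! ### The superposition operator and its Gram kernel -/

noncomputable section
namespace NeuralODE
section Lift

variable {H : Type*} [NormedAddCommGroup H] [InnerProductSpace ℝ H]

theorem posSemidef_gram_pair (h k : H) :
    (!![inner ℝ h h, inner ℝ h k; inner ℝ h k, inner ℝ k k] : Matrix (Fin 2) (Fin 2) ℝ).PosSemidef := by
  have : (!![inner ℝ h h, inner ℝ h k; inner ℝ h k, inner ℝ k k] : Matrix (Fin 2) (Fin 2) ℝ)
      = Matrix.gram ℝ ![h, k] := by
    ext i j
    fin_cases i <;> fin_cases j <;> simp [Matrix.gram_apply, real_inner_comm]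
  rw [this]
  exact Matrix.posSemidef_gram ℝ _

variable {W : H →ₗᵢ[ℝ] Lp ℝ 2 gaussianSeq}
  (hW : ∀ h, charLp (W h) = Complex.exp (-(‖h‖ : ℂ) ^ 2 / 2))

theorem aemeasurable_pair (f g : Lp ℝ 2 gaussianSeq) :
    AEMeasurable (fun ω => (!₂[f ω, g ω] : EuclideanSpace ℝ (Fin 2))) gaussianSeq := by
  have hf := (Lp.aestronglyMeasurable f).aemeasurable
  have hg := (Lp.aestronglyMeasurable g).aemeasurable
  have h : Measurable fun p : ℝ × ℝ => (!₂[p.1, p.2] : EuclideanSpace ℝ (Fin 2)) := by fun_prop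
  exact h.comp_aemeasurable (hf.prodMk hg)

-- Cramér–Wold: by linearity of `W`, the characteristic function of the pair at `t` is `charLp` of
-- `W (t 0 • h + t 1 • k)`.
include hW in
theorem map_pair_eq_pairLaw (h k : H) :
    gaussianSeq.map (fun ω => (!₂[W h ω, W k ω] : EuclideanSpace ℝ (Fin 2)))
      = pairLaw (inner ℝ h h) (inner ℝ h k) (inner ℝ k k) := by
  have : IsFiniteMeasure (pairLaw (inner ℝ h h) (inner ℝ h k) (inner ℝ k k)) := by
    unfold pairLaw; infer_instance
  have hm := aemeasurable_pair (W h) (W k)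
  refine Measure.ext_of_charFun (funext fun t => ?_)
  rw [pairLaw, charFun_multivariateGaussian (posSemidef_gram_pair h k), charFun_apply,
    integral_map hm (by fun_prop)]
  have h1 : ∫ ω, Complex.exp ((inner ℝ (!₂[W h ω, W k ω] : EuclideanSpace ℝ (Fin 2)) t : ℝ)
      * Complex.I) ∂gaussianSeq = charLp (W (t 0 • h + t 1 • k)) := by
    rw [charLp, map_add, map_smul, map_smul]
    refine integral_congr_ae ?_
    filter_upwards [Lp.coeFn_add (t 0 • W h) (t 1 • W k), Lp.coeFn_smul (t 0) (W h),
      Lp.coeFn_smul (t 1) (W k)] with ω h₁ h₂ h₃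
    rw [h₁, Pi.add_apply, h₂, h₃, mul_comm]
    simp [PiLp.inner_apply, Fin.sum_univ_two]
  have h2 : ‖t 0 • h + t 1 • k‖ ^ 2 = t 0 ^ 2 * ‖h‖ ^ 2 + 2 * (t 0 * t 1 * inner ℝ h k)
      + t 1 ^ 2 * ‖k‖ ^ 2 := by
    rw [norm_add_sq_real, norm_smul, norm_smul, mul_pow, mul_pow, Real.norm_eq_abs, sq_abs,
      Real.norm_eq_abs, sq_abs, inner_smul_left, inner_smul_right, RCLike.conj_to_real, mul_assoc]
  rw [h1, hW, ← Complex.ofReal_pow, h2]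
  simp [Matrix.mulVec, dotProduct, Fin.sum_univ_two]
  ring_nf

variable {φ : ℝ → ℝ} {K : ℝ≥0} (hφ : LipschitzWith K φ)
include hφ

theorem memLp_comp_lipschitz (f : Lp ℝ 2 gaussianSeq) :
    MemLp (fun ω => φ (f ω)) 2 gaussianSeq := by
  have h1 : LipschitzWith K fun t => φ t - φ 0 :=
    LipschitzWith.of_dist_le_mul fun a b => by simpa using hφ.dist_le_mul a b
  have h2 := (h1.comp_memLp (by simp) (Lp.memLp f)).add (memLp_const (φ 0))
  refine (memLp_congr_ae (ae_of_all _ fun ω => ?_)).1 h2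
  simp

/-- The superposition operator `h ↦ φ ∘ W h` into `L²`. -/
def superpose (W : H →ₗᵢ[ℝ] Lp ℝ 2 gaussianSeq) (h : H) : Lp ℝ 2 gaussianSeq :=
  (memLp_comp_lipschitz hφ (W h)).toLp _

theorem coeFn_superpose (h : H) :
    superpose hφ W h =ᵐ[gaussianSeq] fun ω => φ (W h ω) := MemLp.coeFn_toLp _

theorem lipschitzWith_superpose : LipschitzWith K (superpose hφ W) := by
  refine LipschitzWith.of_dist_le_mul fun h k => ?_
  rw [dist_eq_norm, dist_eq_norm, ← W.norm_map (h - k), map_sub]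
  refine Lp.norm_le_mul_norm_of_ae_le_mul ?_
  filter_upwards [Lp.coeFn_sub (superpose hφ W h) (superpose hφ W k), coeFn_superpose hφ (W := W) h,
    coeFn_superpose hφ (W := W) k, Lp.coeFn_sub (W h) (W k)] with ω h₁ h₂ h₃ h₄
  rw [h₁, h₄, Pi.sub_apply, Pi.sub_apply, h₂, h₃, ← dist_eq_norm, ← dist_eq_norm]
  exact hφ.dist_le_mul _ _

theorem aestronglyMeasurable_pair_prod (μ : Measure (EuclideanSpace ℝ (Fin 2))) :
    AEStronglyMeasurable (fun w : EuclideanSpace ℝ (Fin 2) => φ (w 0) * φ (w 1)) μ := by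
  have := hφ.continuous
  fun_prop

include hW in
theorem inner_superpose (h k : H) :
    inner ℝ (superpose hφ W h) (superpose hφ W k)
      = dualMoment φ (inner ℝ h h) (inner ℝ h k) (inner ℝ k k) := by
  rw [dualMoment, ← map_pair_eq_pairLaw hW, integral_map (aemeasurable_pair _ _)
    (aestronglyMeasurable_pair_prod hφ _), L2.inner_def]
  refine integral_congr_ae ?_
  filter_upwards [coeFn_superpose hφ (W := W) h, coeFn_superpose hφ (W := W) k] with ω h₁ h₂
  rw [h₁, h₂]
  simp [mul_comm]

include hW in
theorem integrable_pairLaw (h k : H) :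
    Integrable (fun w => φ (w 0) * φ (w 1))
      (pairLaw (inner ℝ h h) (inner ℝ h k) (inner ℝ k k)) := by
  rw [← map_pair_eq_pairLaw hW, integrable_map_measure (aestronglyMeasurable_pair_prod hφ _)
    (aemeasurable_pair _ _)]
  exact (memLp_comp_lipschitz hφ (W h)).integrable_mul (memLp_comp_lipschitz hφ (W k))

end Lift
end NeuralODE
end

/-! ### Kernels as inner products of Euler iterates -/

noncomputable section
namespace NeuralODE

section Kernel

variable {d : ℕ} {φ : ℝ → ℝ} {σu σw κ : ℝ}

theorem preactCov_eq_sum_range (φ : ℝ → ℝ) (σu σw κ : ℝ) (ℓ k : ℕ)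
    (x y : EuclideanSpace ℝ (Fin d)) :
    preactCov φ σu σw κ ℓ k x y = σu ^ 2 / d * inner ℝ x y
      + κ ^ 2 * ∑ i ∈ Finset.range ℓ, ∑ j ∈ Finset.range k,
        kernelC φ σu σw κ (i + 1) (j + 1) x y := by
  rw [preactCov, kernelC_zero_zero, sum_Icc_one_eq_sum_fin,
    Fin.sum_univ_eq_sum_range
      (fun i => ∑ j ∈ Finset.Icc 1 k, kernelC φ σu σw κ (i + 1) j x y) ℓ]
  simp_rw [sum_Icc_one_eq_sum_fin]
  congr 2
  refine Finset.sum_congr rfl fun i _ => ?_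
  exact Fin.sum_univ_eq_sum_range (fun j => kernelC φ σu σw κ (i + 1) (j + 1) x y) k

/-- On the diagonal the recursion only calls diagonal values, so the input enters through `⟪x, x⟫`
alone. -/
theorem preactCov_self_congr (φ : ℝ → ℝ) (σu σw κ : ℝ) {x y : EuclideanSpace ℝ (Fin d)}
    (hxy : inner ℝ x x = inner ℝ y y) (ℓ k : ℕ) :
    preactCov φ σu σw κ ℓ k x x = preactCov φ σu σw κ ℓ k y y := by
  obtain ⟨n, hn⟩ : ∃ n, max ℓ k ≤ n := ⟨_, le_rfl⟩
  induction n using Nat.strong_induction_on generalizing ℓ k with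
  | _ n ih =>
    rw [preactCov_eq_sum_range, preactCov_eq_sum_range, hxy]
    congr 2
    refine Finset.sum_congr rfl fun i hi => Finset.sum_congr rfl fun j hj => ?_
    have hi' := Finset.mem_range.1 hi
    have hj' := Finset.mem_range.1 hj
    rw [kernelC_succ_succ, kernelC_succ_succ, ih (max i j) (by omega) i i (by omega),
      ih (max i j) (by omega) i j (by omega), ih (max i j) (by omega) j j (by omega)]

variable {H : Type*} [NormedAddCommGroup H] [InnerProductSpace ℝ H]
  {z : EuclideanSpace ℝ (Fin d) → H} {G : H → H}

/-- Both iterates are expanded as start plus summed drifts. Cross terms vanish by orthogonality, and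
the drifts at iterates `i`, `j` pair to `C^{i+1,j+1}` by strong induction on `max ℓ k`. -/
theorem preactCov_eq_inner_eulerScheme
    (hz : ∀ x y, inner ℝ (z x) (z y) = σu ^ 2 / d * inner ℝ x y)
    (hzG : ∀ x h, inner ℝ (z x) (G h) = 0)
    (hG : ∀ h k, inner ℝ (G h) (G k)
      = σw ^ 2 * dualMoment φ (inner ℝ h h) (inner ℝ h k) (inner ℝ k k))
    (ℓ k : ℕ) (x y : EuclideanSpace ℝ (Fin d)) :
    preactCov φ σu σw κ ℓ k x y
      = inner ℝ (eulerScheme G κ (z x) ℓ) (eulerScheme G κ (z y) k) := by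
  obtain ⟨n, hn⟩ : ∃ n, max ℓ k ≤ n := ⟨_, le_rfl⟩
  induction n using Nat.strong_induction_on generalizing ℓ k x y with
  | _ n ih =>
    have hGz : ∀ h x, inner ℝ (G h) (z x) = 0 := fun h x => by rw [real_inner_comm, hzG]
    rw [preactCov_eq_sum_range, eulerScheme_eq_sum G κ (z x), eulerScheme_eq_sum G κ (z y)]
    simp only [inner_add_left, inner_add_right, inner_smul_left, inner_smul_right, sum_inner,
      inner_sum, hz, hzG, hGz, Finset.sum_const_zero, mul_zero, add_zero, zero_add,
      RCLike.conj_to_real]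
    rw [← Finset.mul_sum, ← mul_assoc, ← pow_two, Finset.sum_comm]
    congr 2
    refine Finset.sum_congr rfl fun j hj => Finset.sum_congr rfl fun i hi => ?_
    have hi' := Finset.mem_range.1 hi
    have hj' := Finset.mem_range.1 hj
    rw [kernelC_succ_succ, hG, ih (max i j) (by omega) i i x x (by omega),
      ih (max i j) (by omega) i j x y (by omega), ih (max i j) (by omega) j j y y (by omega)]

/-- Pythagoras: all drift increments are orthogonal to `z x - z y`. -/
theorem le_norm_sq_eulerScheme_sub (hz : ∀ x y, inner ℝ (z x) (z y) = σu ^ 2 / d * inner ℝ x y)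
    (hzG : ∀ x h, inner ℝ (z x) (G h) = 0) (x y : EuclideanSpace ℝ (Fin d)) (n m : ℕ) :
    σu ^ 2 / d * ‖x - y‖ ^ 2
      ≤ ‖eulerScheme G κ (z x) n - eulerScheme G κ (z y) m‖ ^ 2 := by
  set a := κ • ∑ i ∈ Finset.range n, G (eulerScheme G κ (z x) i)
    - κ • ∑ i ∈ Finset.range m, G (eulerScheme G κ (z y) i) with ha
  have h1 : eulerScheme G κ (z x) n - eulerScheme G κ (z y) m = (z x - z y) + a := by
    rw [eulerScheme_eq_sum G κ (z x), eulerScheme_eq_sum G κ (z y), ha]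
    abel
  have h2 : inner ℝ (z x - z y) a = 0 := by
    simp [ha, inner_sub_left, inner_sub_right, inner_smul_right, inner_sum, hzG]
  have h3 : ‖z x - z y‖ ^ 2 = σu ^ 2 / d * ‖x - y‖ ^ 2 := by
    rw [← real_inner_self_eq_norm_sq, ← real_inner_self_eq_norm_sq]
    simp only [inner_sub_left, inner_sub_right, hz]
    ring
  rw [h1, norm_add_sq_real, h2, h3]
  nlinarith [sq_nonneg ‖a‖]

theorem norm_sq_le_norm_sq_eulerScheme (hzG : ∀ x h, inner ℝ (z x) (G h) = 0)
    (x : EuclideanSpace ℝ (Fin d)) (n : ℕ) :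
    ‖z x‖ ^ 2 ≤ ‖eulerScheme G κ (z x) n‖ ^ 2 := by
  have h : inner ℝ (z x) (κ • ∑ i ∈ Finset.range n, G (eulerScheme G κ (z x) i)) = 0 := by
    simp [inner_smul_right, inner_sum, hzG]
  rw [eulerScheme_eq_sum G κ (z x), norm_add_sq_real, h]
  nlinarith [sq_nonneg ‖κ • ∑ i ∈ Finset.range n, G (eulerScheme G κ (z x) i)‖]

end Kernel

/-! ### The concrete state space and drift -/

section StateSpace

variable (d : ℕ)

/-- The state space of the limiting equation: the input space together with the Gaussian
feature space. -/
abbrev StateSpace : Type := WithLp 2 (EuclideanSpace ℝ (Fin d) × Lp ℝ 2 gaussianSeq)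

instance : TopologicalSpace.SeparableSpace (StateSpace d) :=
  have : Fact ((2 : ENNReal) ≠ ⊤) := ⟨by norm_num⟩
  have : SecondCountableTopology (Lp ℝ 2 gaussianSeq) := Lp.SecondCountableTopology
  inferInstance

variable {d}

/-- The state associated with the network input `x`. -/
def inputState (σu : ℝ) (x : EuclideanSpace ℝ (Fin d)) : StateSpace d :=
  WithLp.toLp 2 ((σu / Real.sqrt d) • x, 0)

/-- The vector field driving the pre-activations. -/
def drift {φ : ℝ → ℝ} {K : ℝ≥0} (hφ : LipschitzWith K φ) (σw : ℝ)
    (W : StateSpace d →ₗᵢ[ℝ] Lp ℝ 2 gaussianSeq) (h : StateSpace d) : StateSpace d :=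
  WithLp.toLp 2 (0, σw • superpose hφ W h)

theorem inner_inputState (σu : ℝ) (x y : EuclideanSpace ℝ (Fin d)) :
    inner ℝ (inputState σu x) (inputState σu y) = σu ^ 2 / d * inner ℝ x y := by
  have : σu / √d * (σu / √d) = σu ^ 2 / d := by
    rw [div_mul_div_comm, Real.mul_self_sqrt (Nat.cast_nonneg d), pow_two]
  simp only [inputState, WithLp.prod_inner_apply, inner_smul_left, inner_smul_right,
    inner_zero_left, add_zero, RCLike.conj_to_real]
  rw [← mul_assoc, this]

variable {φ : ℝ → ℝ} {K : ℝ≥0} (hφ : LipschitzWith K φ) (σw : ℝ)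
  {W : StateSpace d →ₗᵢ[ℝ] Lp ℝ 2 gaussianSeq}

theorem inner_inputState_drift (σu : ℝ) (x : EuclideanSpace ℝ (Fin d)) (h : StateSpace d) :
    inner ℝ (inputState σu x) (drift hφ σw W h) = 0 := by
  simp [inputState, drift, WithLp.prod_inner_apply]

theorem inner_drift (hW : ∀ h, charLp (W h) = Complex.exp (-(‖h‖ : ℂ) ^ 2 / 2))
    (h k : StateSpace d) :
    inner ℝ (drift hφ σw W h) (drift hφ σw W k)
      = σw ^ 2 * dualMoment φ (inner ℝ h h) (inner ℝ h k) (inner ℝ k k) := by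
  rw [← inner_superpose hW hφ]
  simp only [drift, WithLp.prod_inner_apply, inner_smul_left, inner_smul_right,
    inner_zero_left, zero_add, RCLike.conj_to_real]
  ring

theorem lipschitzWith_drift : LipschitzWith (‖σw‖₊ * K) (drift hφ σw W) := by
  refine LipschitzWith.of_dist_le_mul fun h k => ?_
  have : drift hφ σw W h - drift hφ σw W k
      = WithLp.toLp 2 (0, σw • (superpose hφ W h - superpose hφ W k)) := by
    rw [drift, drift, ← WithLp.toLp_sub, Prod.mk_sub_mk, sub_zero, smul_sub]
  rw [dist_eq_norm, this, WithLp.norm_toLp_snd, norm_smul, NNReal.coe_mul, coe_nnnorm, mul_assoc,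
    ← dist_eq_norm]
  gcongr
  exact (lipschitzWith_superpose hφ).dist_le_mul h k

end StateSpace

end NeuralODE
end

/-! ### The limiting covariance -/

theorem mainTheorem10 {d : ℕ} (φ : ℝ → ℝ) (L₁ : ℝ≥0) (hφ : LipschitzWith L₁ φ)
    (σu σw T : ℝ) (hσu : 0 < σu) (hσw : 0 < σw) (hT : 0 < T)
    (x y : EuclideanSpace ℝ (Fin d))
    (hx : x ∈ Metric.sphere (0 : EuclideanSpace ℝ (Fin d)) 1)
    (hy : y ∈ Metric.sphere (0 : EuclideanSpace ℝ (Fin d)) 1) :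
    -- all Gaussian pairs and expectations in the recursion for `S^L(x, y)` exist
    (∀ L : ℕ, 0 < L → ∀ ℓ ≤ L, ∀ k ≤ L,
      (!![NeuralODE.preactCov φ σu σw (T / L) ℓ ℓ x x, NeuralODE.preactCov φ σu σw (T / L) ℓ k x y;
          NeuralODE.preactCov φ σu σw (T / L) ℓ k x y,
          NeuralODE.preactCov φ σu σw (T / L) k k y y]).PosSemidef ∧
      Integrable (fun w => φ (w 0) * φ (w 1))
        (NeuralODE.pairLaw (NeuralODE.preactCov φ σu σw (T / L) ℓ ℓ x x)
          (NeuralODE.preactCov φ σu σw (T / L) ℓ k x y)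
          (NeuralODE.preactCov φ σu σw (T / L) k k y y))) ∧
    -- the limit defining `S*(x, y)` exists in `ℝ`
    Tendsto (fun L : ℕ => NeuralODE.depthCov φ σu σw T L x y) atTop
      (𝓝 (NeuralODE.limitCov φ σu σw T x y)) ∧
    0 < NeuralODE.limitCov φ σu σw T x x ∧
    NeuralODE.limitCov φ σu σw T x x = NeuralODE.limitCov φ σu σw T y y ∧
    NeuralODE.limitCov φ σu σw T x y ≤ NeuralODE.limitCov φ σu σw T x x ∧
    (NeuralODE.limitCov φ σu σw T x x = NeuralODE.limitCov φ σu σw T x y ↔ x = y) := by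
  -- The unit sphere is empty in dimension zero.
  have hd : 0 < d := by
    rcases Nat.eq_zero_or_pos d with rfl | h
    · simp [Subsingleton.elim x 0] at hx
    · exact h
  have hd' : (0 : ℝ) < d := by exact_mod_cast hd
  have hxn : ‖x‖ = 1 := by simpa using hx
  have hyn : ‖y‖ = 1 := by simpa using hy
  obtain ⟨W, hW⟩ := NeuralODE.exists_isonormal (NeuralODE.StateSpace d)
  set z := NeuralODE.inputState (d := d) σu
  have hz := NeuralODE.inner_inputState (d := d) σu
  have hzG := NeuralODE.inner_inputState_drift (W := W) hφ σw σu
  have hcov := fun κ => NeuralODE.preactCov_eq_inner_eulerScheme (κ := κ) hz hzG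
    (NeuralODE.inner_drift hφ σw hW)
  choose u hu using NeuralODE.exists_tendsto_eulerScheme
    (NeuralODE.lipschitzWith_drift (W := W) hφ σw) hT.le
  have htend : ∀ a b : EuclideanSpace ℝ (Fin d),
      Tendsto (fun L : ℕ => NeuralODE.depthCov φ σu σw T L a b) atTop
        (𝓝 (inner ℝ (u (z a)) (u (z b)))) := fun a b =>
    ((hu (z a)).inner (hu (z b))).congr fun L => (hcov (T / L) L L a b).symm
  have hlim : ∀ a b : EuclideanSpace ℝ (Fin d),
      NeuralODE.limitCov φ σu σw T a b = inner ℝ (u (z a)) (u (z b)) :=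
    fun a b => (htend a b).limUnder_eq
  have hself : NeuralODE.limitCov φ σu σw T x x = NeuralODE.limitCov φ σu σw T y y := by
    rw [hlim, hlim]
    refine tendsto_nhds_unique (htend x x) ((htend y y).congr fun L => ?_)
    exact NeuralODE.preactCov_self_congr φ σu σw _ (by simp [hxn, hyn]) L L
  have hgap : σu ^ 2 / d * ‖x - y‖ ^ 2 ≤ ‖u (z x) - u (z y)‖ ^ 2 :=
    ge_of_tendsto' (((hu (z x)).sub (hu (z y))).norm.pow 2) fun L =>
      NeuralODE.le_norm_sq_eulerScheme_sub hz hzG x y L L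
  -- The square is expanded and the two equal diagonal values merged; the strict gap for `x ≠ y`
  -- comes from here.
  have hgap' : σu ^ 2 / d * ‖x - y‖ ^ 2
      ≤ 2 * (NeuralODE.limitCov φ σu σw T x x - NeuralODE.limitCov φ σu σw T x y) := by
    have h := norm_sub_sq_real (u (z x)) (u (z y))
    rw [← real_inner_self_eq_norm_sq (u (z x)), ← real_inner_self_eq_norm_sq (u (z y)),
      ← hlim, ← hlim, ← hlim] at h
    linarith
  refine ⟨fun L _ ℓ _ k _ => ?_, ?_, ?_, hself, ?_, ?_⟩
  · simp only [hcov]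
    exact ⟨NeuralODE.posSemidef_gram_pair _ _, NeuralODE.integrable_pairLaw hW hφ _ _⟩
  · rw [hlim]
    exact htend x y
  · have h : ‖z x‖ ^ 2 ≤ ‖u (z x)‖ ^ 2 := ge_of_tendsto' ((hu (z x)).norm.pow 2) fun L =>
      NeuralODE.norm_sq_le_norm_sq_eulerScheme hzG x L
    rw [← real_inner_self_eq_norm_sq, hz, real_inner_self_eq_norm_sq, hxn] at h
    rw [hlim, real_inner_self_eq_norm_sq]
    exact lt_of_lt_of_le (by positivity) h
  · have : 0 ≤ σu ^ 2 / d * ‖x - y‖ ^ 2 := by positivity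
    linarith
  · refine ⟨fun h => ?_, fun h => by rw [h]⟩
    by_contra hne
    have : 0 < ‖x - y‖ := norm_pos_iff.2 (sub_ne_zero.2 hne)
    have : 0 < σu ^ 2 / d * ‖x - y‖ ^ 2 := by positivity
    linarith
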